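/- Theorem (implicit function theorem for diffeological étale manifolds). Conventions. A domain is an open subset of some $\mathbb{R}^n$, $n\ge 0$; a plot in a diffeological space $X$ is a smooth map from a domain to $X$; subsets carry the subspace diffeology and products the product diffeology. A subset of $X$ is D-open if its preimage under every plot is open. A map $g:X\to Y$ of diffeological spaces is *étale* if every $x\in X$ has a D-open neighbourhood $O\subseteq X$ such that $g$ restricts to a diffeomorphism from $O$ onto a D-open subset of $Y$. A smooth map $\pi:E\to X$ is a *diffeological étale map* if for every plot $P:U\to X$ the pullback $P^*\pi:\{(r,\xi)\in U\times E\mid P(r)=\pi(\xi)\}\to U$, $(r,\xi)\mapsto r$, is étale. A diffeological space $M$ is a *diffeological étale manifold* of dimension $n$ if it is covered by the images of a family of diffeological étale maps from open subsets of $\mathbb{R}^n$ into $M$. The *internal tangent space* $T_xX$ is the colimit, in real vector spaces, of the tangent spaces $T_0U$ over all plots $P:U\to X$ with $0\in U$ and $P(0)=x$, taken along the differentials $dF_0$ of the germs at $0$ of smooth maps $F$ between the domains with $F(0)=0$ and $Q=P\circ F$ near $0$. With $dP_0:T_0U\to T_xX$ the canonical maps, a smooth map $g:X\to Y$ induces the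 linear map $dg_x:T_xX\to T_{g(x)}Y$ determined by $dg_x\circ dP_0=d(g\circ P)_0$. Statement. Let $M$, $N$ and $L$ be diffeological étale manifolds (of possibly different dimensions) and let $f:M\times N\to L$ be a smooth map. For $x\in M$ let $f^x:N\to L$, $f^x(y)=f(x,y)$. Then the linear map $$d(f^x)_y:T_yN\to T_{f(x,y)}L$$ is an isomorphism for every $(x,y)\in M\times N$ if and only if the track map $$(\mathrm{Pr}_1,f):M\times N\to M\times L,\qquad (x,y)\mapsto (x,f(x,y)),$$ is a diffeological étale map. -/

import Mathlib

open Diffeology TopologicalSpace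
open scoped ContDiff Topology

noncomputable section

namespace EtaleDiffeology

universe u v w

/-! Diffeological spaces, smooth maps and the D-topology are Mathlib's `DiffeologicalSpace`,
`DSmooth` and `dTopology`. -/

section Constructions

/-- The subspace diffeology: the plots of a subset are the plots of the ambient space with values
in the subset. -/
instance instSubtype {X : Type u} [DiffeologicalSpace X] (s : X → Prop) :
    DiffeologicalSpace (Subtype s) where
  plots n := {p : EuclideanSpace ℝ (Fin n) → Subtype s | IsPlot (fun r => (p r : X))}
  constant_plots x := isPlot_const (x := (x : X))
  plot_reparam hp hf := isPlot_reparam hp hf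
  locality hp := DiffeologicalSpace.locality hp

/-- The product diffeology: a plot of `X × Y` is a pair of plots. -/
instance instProd {X : Type u} {Y : Type v} [DiffeologicalSpace X] [DiffeologicalSpace Y] :
    DiffeologicalSpace (X × Y) where
  plots n := {p : EuclideanSpace ℝ (Fin n) → X × Y |
    IsPlot (fun r => (p r).1) ∧ IsPlot (fun r => (p r).2)}
  constant_plots x := ⟨isPlot_const (x := x.1), isPlot_const (x := x.2)⟩
  plot_reparam hp hf := ⟨isPlot_reparam hp.1 hf, isPlot_reparam hp.2 hf⟩
  locality hp := by
    constructor
    · refine DiffeologicalSpace.locality fun x => ?_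
      obtain ⟨u, hu, hxu, h⟩ := hp x
      exact ⟨u, hu, hxu, fun hfu hf => (h hfu hf).1⟩
    · refine DiffeologicalSpace.locality fun x => ?_
      obtain ⟨u, hu, hxu, h⟩ := hp x
      exact ⟨u, hu, hxu, fun hfu hf => (h hfu hf).2⟩

/-- The partial map `f^x : y ↦ f (x, y)` of a smooth map on a product is smooth. -/
theorem dSmooth_slice {X : Type u} {Y : Type v} {Z : Type w} [DiffeologicalSpace X]
    [DiffeologicalSpace Y] [DiffeologicalSpace Z] {f : X × Y → Z} (hf : DSmooth f) (x : X) :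
    DSmooth (fun y : Y => f (x, y)) :=
  fun n p hp => hf n (fun r => (x, p r)) ⟨isPlot_const, hp⟩

end Constructions

section Etale

/-- A diffeomorphism: a smooth map with a smooth two-sided inverse. -/
def IsDiffeomorphism {X : Type u} {Y : Type v} [DiffeologicalSpace X] [DiffeologicalSpace Y]
    (f : X → Y) : Prop :=
  DSmooth f ∧ ∃ g : Y → X, DSmooth g ∧ Function.LeftInverse g f ∧ Function.RightInverse g f

/-- A map `f : X → Y` is étale if each point has a D-open neighbourhood `O` such that `f`
restricts to a diffeomorphism from `O` onto a D-open subset `O'` of `Y`. -/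
def IsEtale {X : Type u} {Y : Type v} [DiffeologicalSpace X] [DiffeologicalSpace Y]
    (f : X → Y) : Prop :=
  ∀ x₀ : X, ∃ (O : Set X) (O' : Set Y), IsOpen[dTopology] O ∧ IsOpen[dTopology] O' ∧
    x₀ ∈ O ∧ f x₀ ∈ O' ∧ ∃ h : Set.MapsTo f O O', IsDiffeomorphism h.restrict

/-- A smooth map `π : E → X` is a diffeological étale map if, for every plot `P : U → X` defined on
a domain `U` (that is, every smooth map from an open subset of some `ℝⁿ`), the pullback
`P^*π : {(r, ξ) ∈ U × E | P r = π ξ} → U`, `(r, ξ) ↦ r`, is étale. -/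
def IsDiffeologicalEtale {E : Type u} {X : Type v} [DiffeologicalSpace E] [DiffeologicalSpace X]
    (π : E → X) : Prop :=
  DSmooth π ∧ ∀ (n : ℕ) (U : Opens (EuclideanSpace ℝ (Fin n))) (P : U → X), DSmooth P →
    IsEtale (fun z : Function.Pullback P π => z.fst)

/-- `M` is a diffeological étale `n`-manifold: there is a family (an atlas) of diffeological étale
maps, defined on open subsets of `ℝⁿ`, whose images cover `M`. -/
def IsEtaleManifold (n : ℕ) (M : Type u) [DiffeologicalSpace M] : Prop :=
  ∃ A : Set ((U : Opens (EuclideanSpace ℝ (Fin n))) × (U → M)),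
    (∀ φ ∈ A, IsDiffeologicalEtale φ.2) ∧ ∀ x : M, ∃ φ ∈ A, x ∈ Set.range φ.2

end Etale

section Tangent

/-- A plot of `X`, defined on an open neighbourhood of `0` in some `ℝⁿ` and centered at `x`. -/
structure CenteredPlot {X : Type u} [DiffeologicalSpace X] (x : X) where
  dim : ℕ
  domain : Opens (EuclideanSpace ℝ (Fin dim))
  zero_mem : (0 : EuclideanSpace ℝ (Fin dim)) ∈ domain
  toFun : domain → X
  smooth : DSmooth toFun
  map_zero : toFun ⟨0, zero_mem⟩ = x

/-- The composite of a centered plot with a smooth map. -/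
abbrev CenteredPlot.map {X : Type u} {Y : Type v} [DiffeologicalSpace X] [DiffeologicalSpace Y]
    {f : X → Y} (hf : DSmooth f) {x : X} (P : CenteredPlot x) : CenteredPlot (f x) where
  dim := P.dim
  domain := P.domain
  zero_mem := P.zero_mem
  toFun := f ∘ P.toFun
  smooth := hf.comp P.smooth
  map_zero := congrArg f P.map_zero

/-- `F` represents a germ of a morphism from the centered plot `Q` to the centered plot `P`: on some
open neighbourhood `W` of `0` in the domain of `Q`, it is smooth with values in the domain of `P`
and `Q = P ∘ F`; moreover `F 0 = 0`. -/
def CenteredPlot.IsHom {X : Type u} [DiffeologicalSpace X] {x : X} (Q P : CenteredPlot x)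
    (F : EuclideanSpace ℝ (Fin Q.dim) → EuclideanSpace ℝ (Fin P.dim)) : Prop :=
  F 0 = 0 ∧ ∃ W : Opens (EuclideanSpace ℝ (Fin Q.dim)), 0 ∈ W ∧ ContDiffOn ℝ ∞ F W ∧
    ∀ r ∈ W, ∃ (hQ : r ∈ Q.domain) (hP : F r ∈ P.domain), Q.toFun ⟨r, hQ⟩ = P.toFun ⟨F r, hP⟩

open Classical in
/-- The relations `(Q, v) = (P, dF₀ v)`, one for each morphism `F : Q → P` of centered plots and
each vector `v`, in the direct sum of the tangent spaces `T₀ (dom P) = ℝⁿ`. -/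
def tangentRelations {X : Type u} [DiffeologicalSpace X] (x : X) :
    Submodule ℝ (DirectSum (CenteredPlot x) fun P => EuclideanSpace ℝ (Fin P.dim)) :=
  Submodule.span ℝ {t | ∃ (Q P : CenteredPlot x)
    (F : EuclideanSpace ℝ (Fin Q.dim) → EuclideanSpace ℝ (Fin P.dim))
    (v : EuclideanSpace ℝ (Fin Q.dim)), Q.IsHom P F ∧
    t = DirectSum.lof ℝ (CenteredPlot x) (fun P => EuclideanSpace ℝ (Fin P.dim)) Q v -
      DirectSum.lof ℝ (CenteredPlot x) (fun P => EuclideanSpace ℝ (Fin P.dim)) P (fderiv ℝ F 0 v)}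

/-- The internal tangent space `T_x X`: the colimit, in real vector spaces, of the tangent spaces at
`0` of the domains of the plots centered at `x`, along the differentials at `0` of the morphisms of
germs of centered plots. -/
abbrev InternalTangentSpace {X : Type u} [DiffeologicalSpace X] (x : X) : Type u :=
  (DirectSum (CenteredPlot x) fun P => EuclideanSpace ℝ (Fin P.dim)) ⧸ tangentRelations x

open Classical in
/-- The canonical map `dP₀ : T₀ (dom P) → T_x X` into the colimit. -/
def CenteredPlot.d {X : Type u} [DiffeologicalSpace X] {x : X} (P : CenteredPlot x) :
    EuclideanSpace ℝ (Fin P.dim) →ₗ[ℝ] InternalTangentSpace x :=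
  (tangentRelations x).mkQ ∘ₗ
    DirectSum.lof ℝ (CenteredPlot x) (fun P => EuclideanSpace ℝ (Fin P.dim)) P

theorem CenteredPlot.IsHom.map {X : Type u} {Y : Type v} [DiffeologicalSpace X]
    [DiffeologicalSpace Y] {f : X → Y} (hf : DSmooth f) {x : X} {Q P : CenteredPlot x}
    {F : EuclideanSpace ℝ (Fin Q.dim) → EuclideanSpace ℝ (Fin P.dim)} (h : Q.IsHom P F) :
    (Q.map hf).IsHom (P.map hf) F := by
  obtain ⟨h0, W, hW, hF, hr⟩ := h
  refine ⟨h0, W, hW, hF, fun r hrW => ?_⟩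
  obtain ⟨hQ, hP, he⟩ := hr r hrW
  exact ⟨hQ, hP, congrArg f he⟩

/-- The cocone identity `dP₀ ∘ dF₀ = dQ₀`. -/
theorem CenteredPlot.IsHom.d_comp {X : Type u} [DiffeologicalSpace X] {x : X} {Q P : CenteredPlot x}
    {F : EuclideanSpace ℝ (Fin Q.dim) → EuclideanSpace ℝ (Fin P.dim)} (h : Q.IsHom P F)
    (v : EuclideanSpace ℝ (Fin Q.dim)) : P.d (fderiv ℝ F 0 v) = Q.d v := by
  symm
  refine (Submodule.Quotient.eq (tangentRelations x)).2 (Submodule.subset_span ?_)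
  exact ⟨Q, P, F, v, h, rfl⟩

open Classical in
/-- The internal tangent map `df_x : T_x X → T_{f x} Y` of a smooth map `f`, induced by
`dP₀ ↦ d(f ∘ P)₀` on the colimits. -/
def internalTangentMap {X : Type u} {Y : Type v} [DiffeologicalSpace X] [DiffeologicalSpace Y]
    {f : X → Y} (hf : DSmooth f) (x : X) :
    InternalTangentSpace x →ₗ[ℝ] InternalTangentSpace (f x) :=
  (tangentRelations x).liftQ
    (DirectSum.toModule ℝ (CenteredPlot x) (InternalTangentSpace (f x)) fun P => (P.map hf).d) <| by
    refine Submodule.span_le.2 ?_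
    rintro _ ⟨Q, P, F, v, h, rfl⟩
    rw [SetLike.mem_coe, LinearMap.mem_ker, map_sub, DirectSum.toModule_lof,
      DirectSum.toModule_lof, sub_eq_zero]
    exact ((h.map hf).d_comp v).symm

/-- The characterizing property `df_x ∘ dP₀ = d(f ∘ P)₀` of the internal tangent map. -/
theorem internalTangentMap_d {X : Type u} {Y : Type v} [DiffeologicalSpace X]
    [DiffeologicalSpace Y] {f : X → Y} (hf : DSmooth f) {x : X} (P : CenteredPlot x)
    (v : EuclideanSpace ℝ (Fin P.dim)) : internalTangentMap hf x (P.d v) = (P.map hf).d v := by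
  classical
  unfold internalTangentMap CenteredPlot.d
  exact DirectSum.toModule_lof ℝ (φ := fun P : CenteredPlot x => (P.map hf).d) P v

end Tangent

end EtaleDiffeology

end

/-! Étaleness is a condition on germs of plots: `π` is a diffeological étale map exactly when
every germ of a plot through `π x` lifts to a unique germ of a plot through `x`. Such maps satisfy
the cancellation rules of étale maps and induce isomorphisms of internal tangent spaces, and for
smooth maps of vector spaces the inverse function theorem gives a converse. If the track map is
étale, so are the slices of `f`. Conversely, replacing `M` by the domain of a plot and `N`, `L` by
charts turns the track map into `(r, v) ↦ (r, F (r, v))`, whose derivative is invertible as soon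
as the derivative in `v` is. -/

namespace EtaleDiffeology

universe u v w

local notation "𝔼" n:max => EuclideanSpace ℝ (Fin n)

section Calculus

theorem exists_contDiff_mem_eventuallyEq_id {E : Type*} [NormedAddCommGroup E] [NormedSpace ℝ E]
    [HasContDiffBump E] {x : E} {s : Set E} (hs : s ∈ 𝓝 x) :
    ∃ κ : E → E, ContDiff ℝ ∞ κ ∧ (∀ r, κ r ∈ s) ∧ κ =ᶠ[𝓝 x] id := by
  obtain ⟨ε, hε, hball⟩ := Metric.mem_nhds_iff.1 hs
  let b : ContDiffBump x := ⟨ε / 4, ε / 2, by positivity, by linarith⟩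
  refine ⟨fun r => x + b r • (r - x), ?_, fun r => hball ?_, ?_⟩
  · exact contDiff_const.add (b.contDiff.smul (contDiff_id.sub contDiff_const))
  · rw [mem_ball_iff_norm, add_sub_cancel_left, norm_smul, Real.norm_of_nonneg b.nonneg]
    by_cases hr : r ∈ Metric.ball x (ε / 2)
    · rw [mem_ball_iff_norm] at hr
      calc b r * ‖r - x‖ ≤ 1 * ‖r - x‖ := by gcongr; exact b.le_one
        _ < ε := by linarith
    · rw [b.zero_of_le_dist (by simpa using hr), zero_mul]
      exact hε
  · filter_upwards [b.eventuallyEq_one] with r hr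
    simp [hr]

/-- `ContDiffAt ℝ ∞` for the inverse at one point only bounds each finite order on a neighbourhood
depending on the order; restricting to the open set where the derivative is invertible gives
smoothness on one neighbourhood. -/
theorem exists_openPartialHomeomorph_contDiffOn_symm {A B : Type*} [NormedAddCommGroup A]
    [NormedSpace ℝ A] [CompleteSpace A] [NormedAddCommGroup B] [NormedSpace ℝ B] [CompleteSpace B]
    {Φ : A → B} (hΦ : ContDiff ℝ ∞ Φ) {a : A} (ha : Function.Bijective (fderiv ℝ Φ a)) :
    ∃ H : OpenPartialHomeomorph A B, a ∈ H.source ∧ ⇑H = Φ ∧ ContDiffOn ℝ ∞ H.symm H.target := by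
  have hderiv (b : A) : HasFDerivAt Φ (fderiv ℝ Φ b) b :=
    (hΦ.differentiable (by simp) b).hasFDerivAt
  let e : A ≃L[ℝ] B := ContinuousLinearEquiv.ofBijective (fderiv ℝ Φ a)
    (LinearMap.ker_eq_bot.2 ha.1) (LinearMap.range_eq_top.2 ha.2)
  have he : (e : A →L[ℝ] B) = fderiv ℝ Φ a := rfl
  let H := hΦ.contDiffAt.toOpenPartialHomeomorph Φ (he ▸ hderiv a) (by simp)
  let s : Set A := fderiv ℝ Φ ⁻¹' Set.range ((↑) : (A ≃L[ℝ] B) → A →L[ℝ] B)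
  have hs : IsOpen s := ContinuousLinearEquiv.isOpen.preimage (hΦ.continuous_fderiv (by simp))
  refine ⟨H.restrOpen s hs, ⟨?_, e, he⟩, rfl, ?_⟩
  · exact hΦ.contDiffAt.mem_toOpenPartialHomeomorph_source (he ▸ hderiv a) (by simp)
  · rintro b ⟨hb, e', he'⟩
    exact (H.contDiffAt_symm hb (he' ▸ hderiv _) hΦ.contDiffAt).contDiffWithinAt

theorem bijective_fderiv_fst_prodMk {E V W : Type*} [NormedAddCommGroup E] [NormedSpace ℝ E]
    [NormedAddCommGroup V] [NormedSpace ℝ V] [NormedAddCommGroup W] [NormedSpace ℝ W]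
    {F : E × V → W} {e : E} {v : V} (hF : DifferentiableAt ℝ F (e, v))
    (h : Function.Bijective (fderiv ℝ (fun v => F (e, v)) v)) :
    Function.Bijective (fderiv ℝ (fun z : E × V => (z.1, F z)) (e, v)) := by
  let A := fderiv ℝ F (e, v)
  have hslice : fderiv ℝ (fun v => F (e, v)) v = A.comp (ContinuousLinearMap.inr ℝ E V) :=
    (hF.hasFDerivAt.comp v (hasFDerivAt_prodMk_right e v)).fderiv
  have htrack : fderiv ℝ (fun z : E × V => (z.1, F z)) (e, v) =
      (ContinuousLinearMap.fst ℝ E V).prod A := (hasFDerivAt_fst.prodMk hF.hasFDerivAt).fderiv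
  rw [hslice] at h
  let T : (E × V) ≃ₗ[ℝ] E × W := (LinearEquiv.refl ℝ E).skewProd
    (LinearEquiv.ofBijective (A.comp (ContinuousLinearMap.inr ℝ E V)).toLinearMap h)
    (A.comp (ContinuousLinearMap.inl ℝ E V)).toLinearMap
  have hT : ⇑T = fderiv ℝ (fun z : E × V => (z.1, F z)) (e, v) := by
    funext z
    rw [htrack]
    refine Prod.ext rfl ?_
    change A (0, z.2) + A (z.1, 0) = A z
    rw [← map_add, Prod.mk_add_mk, zero_add, add_zero]
  exact hT ▸ T.bijective

end Calculus

section Smooth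

variable {X : Type u} {Y : Type v} {Z : Type w} [DiffeologicalSpace X] [DiffeologicalSpace Y]
  [DiffeologicalSpace Z]

theorem dSmooth_val {s : X → Prop} : DSmooth (Subtype.val : Subtype s → X) := fun _ _ hp => hp

theorem dSmooth_fst : DSmooth (Prod.fst : X × Y → X) := fun _ _ hp => hp.1

theorem dSmooth_snd : DSmooth (Prod.snd : X × Y → Y) := fun _ _ hp => hp.2

theorem dSmooth_prodMk {f : X → Y} {g : X → Z} (hf : DSmooth f) (hg : DSmooth g) :
    DSmooth fun x => (f x, g x) :=
  fun n p hp => ⟨hf n p hp, hg n p hp⟩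

instance {A B : Type*} [NormedAddCommGroup A] [NormedSpace ℝ A] [DiffeologicalSpace A]
    [IsContDiffCompatible A] [NormedAddCommGroup B] [NormedSpace ℝ B] [DiffeologicalSpace B]
    [IsContDiffCompatible B] : IsContDiffCompatible (A × B) where
  isPlot_iff := ⟨fun h => h.1.contDiff.prodMk h.2.contDiff, fun h => ⟨h.fst.isPlot, h.snd.isPlot⟩⟩

end Smooth

section UniqueLifts

variable {X : Type u} {Y : Type v} {Z : Type w} [DiffeologicalSpace X] [DiffeologicalSpace Y]
  [DiffeologicalSpace Z] {f : X → Y} {g : Y → Z} {x : X}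

/-- Étaleness of `π` at the point `x` in terms of germs: every germ of a plot through `π x` lifts
along `π` to a unique germ of a plot through `x`. Germs are represented by plots defined on a whole
space `ℝⁿ`, which loses nothing. -/
structure HasUniqueLiftsAt (π : X → Y) (x : X) : Prop where
  exists_lift : ∀ {n : ℕ} {p : 𝔼 n → Y}, IsPlot p → ∀ {r₀ : 𝔼 n}, p r₀ = π x →
    ∃ q : 𝔼 n → X, IsPlot q ∧ q r₀ = x ∧ π ∘ q =ᶠ[𝓝 r₀] p
  eventuallyEq : ∀ {n : ℕ} {q q' : 𝔼 n → X}, IsPlot q → IsPlot q' → ∀ {r₀ : 𝔼 n}, q r₀ = x →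
    q' r₀ = x → π ∘ q =ᶠ[𝓝 r₀] π ∘ q' → q =ᶠ[𝓝 r₀] q'

theorem hasUniqueLiftsAt_id : HasUniqueLiftsAt id x where
  exists_lift hp _ h0 := ⟨_, hp, h0, .rfl⟩
  eventuallyEq _ _ _ _ _ he := he

theorem HasUniqueLiftsAt.comp (hg : HasUniqueLiftsAt g (f x)) (hf : HasUniqueLiftsAt f x)
    (hfs : DSmooth f) : HasUniqueLiftsAt (g ∘ f) x where
  exists_lift hp _ h0 := by
    obtain ⟨q, hq, hq0, hqp⟩ := hg.exists_lift hp h0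
    obtain ⟨s, hs, hs0, hsq⟩ := hf.exists_lift hq hq0
    exact ⟨s, hs, hs0, (hsq.fun_comp g).trans hqp⟩
  eventuallyEq hq hq' _ h0 h0' he :=
    hf.eventuallyEq hq hq' h0 h0' <| hg.eventuallyEq (hfs _ _ hq) (hfs _ _ hq')
      (congrArg f h0) (congrArg f h0') he

theorem HasUniqueLiftsAt.of_comp_left (hgf : HasUniqueLiftsAt (g ∘ f) x)
    (hg : HasUniqueLiftsAt g (f x)) (hgs : DSmooth g) (hfs : DSmooth f) :
    HasUniqueLiftsAt f x where
  exists_lift hp _ h0 := by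
    obtain ⟨q, hq, hq0, hqp⟩ := hgf.exists_lift (hgs _ _ hp) (congrArg g h0)
    exact ⟨q, hq, hq0, hg.eventuallyEq (hfs _ _ hq) hp (congrArg f hq0) h0 hqp⟩
  eventuallyEq hq hq' _ h0 h0' he := hgf.eventuallyEq hq hq' h0 h0' (he.fun_comp g)

theorem HasUniqueLiftsAt.of_comp_right (hgf : HasUniqueLiftsAt (g ∘ f) x)
    (hf : HasUniqueLiftsAt f x) (hfs : DSmooth f) : HasUniqueLiftsAt g (f x) where
  exists_lift hp _ h0 := by
    obtain ⟨q, hq, hq0, hqp⟩ := hgf.exists_lift hp h0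
    exact ⟨f ∘ q, hfs _ _ hq, congrArg f hq0, hqp⟩
  eventuallyEq {n q q'} hq hq' r₀ h0 h0' he := by
    obtain ⟨s, hs, hs0, hsq⟩ := hf.exists_lift hq h0
    obtain ⟨s', hs', hs0', hsq'⟩ := hf.exists_lift hq' h0'
    have hss' : s =ᶠ[𝓝 r₀] s' := hgf.eventuallyEq hs hs' hs0 hs0' <|
      ((hsq.fun_comp g).trans he).trans (hsq'.fun_comp g).symm
    exact hsq.symm.trans ((hss'.fun_comp f).trans hsq')

theorem HasUniqueLiftsAt.prodMap {X' : Type*} {Y' : Type*} [DiffeologicalSpace X']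
    [DiffeologicalSpace Y'] {f' : X' → Y'} {x' : X'} (hf : HasUniqueLiftsAt f x)
    (hf' : HasUniqueLiftsAt f' x') : HasUniqueLiftsAt (Prod.map f f') (x, x') where
  exists_lift hp _ h0 := by
    obtain ⟨q, hq, hq0, hqp⟩ := hf.exists_lift hp.1 (congrArg Prod.fst h0)
    obtain ⟨q', hq', hq0', hqp'⟩ := hf'.exists_lift hp.2 (congrArg Prod.snd h0)
    exact ⟨fun r => (q r, q' r), ⟨hq, hq'⟩, Prod.ext hq0 hq0', hqp.prodMk hqp'⟩
  eventuallyEq hq hq' _ h0 h0' he :=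
    (hf.eventuallyEq hq.1 hq'.1 (congrArg Prod.fst h0) (congrArg Prod.fst h0')
      (he.fun_comp Prod.fst)).prodMk
    (hf'.eventuallyEq hq.2 hq'.2 (congrArg Prod.snd h0) (congrArg Prod.snd h0')
      (he.fun_comp Prod.snd))

theorem hasUniqueLiftsAt_val {O : Set X} (hO : IsOpen[dTopology] O) (x : O) :
    HasUniqueLiftsAt (Subtype.val : O → X) x where
  exists_lift {n p} hp r₀ h0 := by
    have hr₀ : p ⁻¹' O ∈ 𝓝 r₀ :=
      (isOpen_iff_preimages_plots.1 hO n p hp).mem_nhds (h0 ▸ x.2 : p r₀ ∈ O)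
    obtain ⟨κ, hκ, hκO, hκid⟩ := exists_contDiff_mem_eventuallyEq_id hr₀
    exact ⟨fun r => ⟨p (κ r), hκO r⟩, isPlot_reparam hp hκ,
      Subtype.ext ((congrArg p hκid.self_of_nhds).trans h0), hκid.fun_comp p⟩
  eventuallyEq _ _ _ _ _ he := he.mono fun _ hr => Subtype.ext hr

theorem IsDiffeomorphism.hasUniqueLiftsAt (hf : IsDiffeomorphism f) (x : X) :
    HasUniqueLiftsAt f x := by
  obtain ⟨-, g, hg, hleft, hright⟩ := hf
  exact
    { exists_lift := fun {_ p} hp _ h0 => ⟨g ∘ p, hg _ _ hp, (congrArg g h0).trans (hleft x),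
        .of_forall fun r => hright (p r)⟩
      eventuallyEq := fun _ _ _ _ _ he => he.mono fun _ hr => hleft.injective hr }

theorem IsEtale.hasUniqueLiftsAt (hf : IsEtale f) (x : X) : HasUniqueLiftsAt f x := by
  obtain ⟨O, O', hO, hO', hx, -, hmaps, hdiffeo⟩ := hf x
  have hrestrict : HasUniqueLiftsAt (Subtype.val ∘ hmaps.restrict f O O') ⟨x, hx⟩ :=
    (hasUniqueLiftsAt_val hO' _).comp (hdiffeo.hasUniqueLiftsAt _) hdiffeo.1
  exact HasUniqueLiftsAt.of_comp_right (f := (Subtype.val : O → X)) hrestrict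
    (hasUniqueLiftsAt_val hO ⟨x, hx⟩) dSmooth_val

theorem isEtale_of_hasUniqueLiftsAt {n : ℕ} {U : Opens (𝔼 n)} {f : X → U} (hf : DSmooth f)
    (h : ∀ x, HasUniqueLiftsAt f x) : IsEtale f := by
  intro x₀
  obtain ⟨κ, hκ, hκU, hκid⟩ := exists_contDiff_mem_eventuallyEq_id (U.isOpen.mem_nhds (f x₀).2)
  have hκplot : IsPlot κ := hκ.isPlot
  obtain ⟨σ, hσ, hσ0, hσκ⟩ := (h x₀).exists_lift (p := fun r => ⟨κ r, hκU r⟩) hκplot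
    (Subtype.ext hκid.self_of_nhds)
  have hsection : ∀ᶠ r in 𝓝 (f x₀ : 𝔼 n), (f (σ r) : 𝔼 n) = r := by
    filter_upwards [hσκ, hκid] with r hr hr'
    exact (congrArg Subtype.val hr).trans hr'
  obtain ⟨W, hWsec, hW, hxW⟩ := eventually_nhds_iff.1 hsection
  refine ⟨{x | (f x : 𝔼 n) ∈ W ∧ σ (f x) = x}, {r | (r : 𝔼 n) ∈ W}, ?_, ?_, ⟨hxW, hσ0⟩, hxW,
    fun x hx => hx.1, fun k p hp => hf k _ hp,
    fun r => ⟨σ r, ?_⟩, fun k p hp => hσ.dSmooth k _ hp, fun x => Subtype.ext x.2.2,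
    fun r => Subtype.ext (Subtype.ext (hWsec r r.2))⟩
  · refine isOpen_iff_preimages_plots.2 fun k s hs => isOpen_iff_mem_nhds.2 fun t ht => ?_
    have hfs : ContDiff ℝ ∞ fun t => (f (s t) : 𝔼 n) := (dSmooth_val _ _ (hf k s hs)).contDiff
    have hsW := (hW.preimage hfs.continuous).mem_nhds ht.1
    have hlift : σ ∘ (fun t => (f (s t) : 𝔼 n)) =ᶠ[𝓝 t] s := by
      refine (h (s t)).eventuallyEq (isPlot_reparam hσ hfs) hs ht.2 rfl ?_
      filter_upwards [hsW] with t' ht'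
      exact Subtype.ext (hWsec _ ht')
    exact Filter.inter_mem hsW hlift
  · exact isOpen_iff_preimages_plots.2 fun k s hs =>
      hW.preimage (IsPlot.contDiff (p := fun t => (s t : 𝔼 n)) hs).continuous
  · exact ⟨(congrArg (· ∈ W) (hWsec r r.2)).mpr r.2, congrArg σ (hWsec r r.2)⟩

theorem HasUniqueLiftsAt.pullback_fst {P : Z → Y} (hP : DSmooth P) (z : Function.Pullback P f)
    (h : HasUniqueLiftsAt f z.snd) :
    HasUniqueLiftsAt (fun z : Function.Pullback P f => z.fst) z where
  exists_lift {n b} hb r₀ h0 := by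
    obtain ⟨q, hq, hq0, hqb⟩ := h.exists_lift (hP n b hb) ((congrArg P h0).trans z.2)
    obtain ⟨κ, hκ, hκs, hκid⟩ := exists_contDiff_mem_eventuallyEq_id hqb
    refine ⟨fun r => ⟨(b (κ r), q (κ r)), (hκs r).symm⟩,
      ⟨isPlot_reparam hb hκ, isPlot_reparam hq hκ⟩, ?_, hκid.fun_comp b⟩
    exact Subtype.ext (Prod.ext ((congrArg b hκid.self_of_nhds).trans h0)
      ((congrArg q hκid.self_of_nhds).trans hq0))
  eventuallyEq {n q q'} hq hq' r₀ h0 h0' he := by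
    have hsnd : (fun r => (q r).snd) =ᶠ[𝓝 r₀] fun r => (q' r).snd := by
      refine h.eventuallyEq hq.2 hq'.2 (congrArg (·.snd) h0) (congrArg (·.snd) h0') ?_
      filter_upwards [he] with r hr
      exact (q r).2.symm.trans ((congrArg P hr).trans (q' r).2)
    filter_upwards [he, hsnd] with r hr hr'
    exact Subtype.ext (Prod.ext hr hr')

theorem IsDiffeologicalEtale.hasUniqueLiftsAt (hf : IsDiffeologicalEtale f) (x : X) :
    HasUniqueLiftsAt f x := by
  have hpullback {n : ℕ} {p : 𝔼 n → Y} (hp : IsPlot p)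
      (z : Function.Pullback (fun r : (⊤ : Opens (𝔼 n)) => p r) f) :
      HasUniqueLiftsAt
        (fun z : Function.Pullback (fun r : (⊤ : Opens (𝔼 n)) => p r) f => z.fst) z :=
    (hf.2 n ⊤ _ (hp.dSmooth.comp dSmooth_val)).hasUniqueLiftsAt z
  constructor
  · intro n p hp r₀ h0
    obtain ⟨s, hs, hs0, hsid⟩ := (hpullback hp ⟨(⟨r₀, trivial⟩, x), h0⟩).exists_lift
      (p := fun r => ⟨r, trivial⟩) isPlot_id rfl
    refine ⟨fun r => (s r).snd, hs.2, congrArg (·.snd) hs0, ?_⟩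
    filter_upwards [hsid] with r hr
    exact (s r).2.symm.trans (congrArg (fun r : (⊤ : Opens (𝔼 n)) => p r) hr)
  · intro n q q' hq hq' r₀ h0 h0' he
    obtain ⟨κ, hκ, hκs, hκid⟩ := exists_contDiff_mem_eventuallyEq_id he
    have hκ0 : κ r₀ = r₀ := hκid.self_of_nhds
    have hlifts := (hpullback (hf.1 n _ (isPlot_reparam hq hκ))
      ⟨(⟨r₀, trivial⟩, x), congrArg f ((congrArg q hκ0).trans h0)⟩).eventuallyEq
      (q := fun r => ⟨(⟨r, trivial⟩, q (κ r)), rfl⟩)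
      (q' := fun r => ⟨(⟨r, trivial⟩, q' (κ r)), hκs r⟩)
      ⟨isPlot_id, isPlot_reparam hq hκ⟩ ⟨isPlot_id, isPlot_reparam hq' hκ⟩
      (r₀ := r₀) (Subtype.ext (Prod.ext rfl ((congrArg q hκ0).trans h0)))
      (Subtype.ext (Prod.ext rfl ((congrArg q' hκ0).trans h0'))) .rfl
    filter_upwards [hlifts, hκid] with r hr hκr
    have hsnd : q (κ r) = q' (κ r) := congrArg (·.snd) hr
    rwa [hκr] at hsnd

theorem isDiffeologicalEtale_iff :
    IsDiffeologicalEtale f ↔ DSmooth f ∧ ∀ x, HasUniqueLiftsAt f x :=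
  ⟨fun h => ⟨h.1, h.hasUniqueLiftsAt⟩, fun h => ⟨h.1, fun _ _ _ hP =>
    isEtale_of_hasUniqueLiftsAt (dSmooth_fst.comp dSmooth_val)
      fun z => (h.2 z.snd).pullback_fst hP z⟩⟩

end UniqueLifts

section NormedSpace

variable {A B : Type*} [NormedAddCommGroup A] [NormedSpace ℝ A] [DiffeologicalSpace A]
  [IsContDiffCompatible A] [NormedAddCommGroup B] [NormedSpace ℝ B] [DiffeologicalSpace B]
  [IsContDiffCompatible B] {X : Type u} {Y : Type v} [DiffeologicalSpace X] [DiffeologicalSpace Y]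

theorem HasUniqueLiftsAt.congr {f g : A → Y} {a : A} (hf : HasUniqueLiftsAt f a)
    (hfg : f =ᶠ[𝓝 a] g) : HasUniqueLiftsAt g a := by
  have hcomp {n : ℕ} {q : 𝔼 n → A} (hq : IsPlot q) {r₀ : 𝔼 n} (h0 : q r₀ = a) :
      f ∘ q =ᶠ[𝓝 r₀] g ∘ q :=
    hfg.comp_tendsto (h0 ▸ hq.contDiff.continuous.tendsto r₀)
  constructor
  · intro n p hp r₀ h0
    obtain ⟨q, hq, hq0, hqp⟩ := hf.exists_lift hp (h0.trans hfg.self_of_nhds.symm)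
    exact ⟨q, hq, hq0, (hcomp hq hq0).symm.trans hqp⟩
  · intro n q q' hq hq' r₀ h0 h0' he
    exact hf.eventuallyEq hq hq' h0 h0' (((hcomp hq h0).trans he).trans (hcomp hq' h0').symm)

theorem hasUniqueLiftsAt_of_bijective_fderiv [CompleteSpace A] [CompleteSpace B] {Φ : A → B}
    (hΦ : ContDiff ℝ ∞ Φ) {a : A} (ha : Function.Bijective (fderiv ℝ Φ a)) :
    HasUniqueLiftsAt Φ a := by
  obtain ⟨H, haH, rfl, hsymm⟩ := exists_openPartialHomeomorph_contDiffOn_symm hΦ ha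
  constructor
  · intro n p hp r₀ h0
    have hp' : ContDiff ℝ ∞ p := hp.contDiff
    have htarget : ∀ᶠ r in 𝓝 r₀, p r ∈ H.target := hp'.continuous.continuousAt.eventually_mem <|
      H.open_target.mem_nhds (h0 ▸ H.map_source haH)
    obtain ⟨κ, hκ, hκH, hκid⟩ := exists_contDiff_mem_eventuallyEq_id htarget
    refine ⟨H.symm ∘ p ∘ κ, (hsymm.comp_contDiff (hp'.comp hκ) hκH).isPlot, ?_, ?_⟩
    · rw [Function.comp_apply, Function.comp_apply, hκid.self_of_nhds, id, h0, H.left_inv haH]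
    · filter_upwards [hκid] with r hr
      exact (H.right_inv (hκH r)).trans (congrArg p hr)
  · intro n q q' hq hq' r₀ h0 h0' he
    have hsource {q : 𝔼 n → A} (hq : IsPlot q) (h0 : q r₀ = a) : ∀ᶠ r in 𝓝 r₀, q r ∈ H.source :=
      hq.contDiff.continuous.continuousAt.eventually_mem (H.open_source.mem_nhds (h0 ▸ haH))
    filter_upwards [he, hsource hq h0, hsource hq' h0'] with r hr hqr hqr'
    exact H.injOn hqr hqr' hr

theorem HasUniqueLiftsAt.exists_lift_normedSpace [FiniteDimensional ℝ A] {π : X → Y} {x : X}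
    (hπ : HasUniqueLiftsAt π x) {g : A → Y} (hg : DSmooth g) {a : A} (ha : g a = π x) :
    ∃ G : A → X, DSmooth G ∧ G a = x ∧ π ∘ G =ᶠ[𝓝 a] g := by
  let e : A ≃L[ℝ] 𝔼 (Module.finrank ℝ A) := toEuclidean
  obtain ⟨q, hq, hq0, hqg⟩ := hπ.exists_lift (p := g ∘ e.symm) (r₀ := e a)
    (hg _ _ e.symm.contDiff.isPlot) (by simpa using ha)
  refine ⟨q ∘ e, hq.dSmooth.comp e.contDiff.dSmooth, hq0, ?_⟩
  filter_upwards [(e.continuous.tendsto a).eventually hqg] with b hb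
  simpa using hb

end NormedSpace

section Tangent

variable {X : Type u} {Y : Type v} [DiffeologicalSpace X] [DiffeologicalSpace Y] {x : X}

theorem CenteredPlot.exists_isPlot_eventually (P : CenteredPlot x) :
    ∃ p : 𝔼 P.dim → X, IsPlot p ∧ ∀ᶠ r in 𝓝 0, ∃ h : r ∈ P.domain, p r = P.toFun ⟨r, h⟩ := by
  obtain ⟨κ, hκ, hκP, hκid⟩ :=
    exists_contDiff_mem_eventuallyEq_id (P.domain.isOpen.mem_nhds P.zero_mem)
  refine ⟨fun r => P.toFun ⟨κ r, hκP r⟩, P.smooth _ _ hκ.isPlot, ?_⟩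
  filter_upwards [hκid] with r (hr : κ r = r)
  exact ⟨hr ▸ hκP r, congrArg P.toFun (Subtype.ext hr)⟩

/-- A plot on the whole space with the same germ at `0` as a centered plot, so that germs can be
handled without mentioning domains. -/
noncomputable def CenteredPlot.extension (P : CenteredPlot x) : 𝔼 P.dim → X :=
  P.exists_isPlot_eventually.choose

theorem CenteredPlot.isPlot_extension (P : CenteredPlot x) : IsPlot P.extension :=
  P.exists_isPlot_eventually.choose_spec.1

theorem CenteredPlot.eventually_extension_eq (P : CenteredPlot x) :
    ∀ᶠ r in 𝓝 0, ∃ h : r ∈ P.domain, P.extension r = P.toFun ⟨r, h⟩ :=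
  P.exists_isPlot_eventually.choose_spec.2

theorem CenteredPlot.extension_zero (P : CenteredPlot x) : P.extension 0 = x := by
  obtain ⟨_, h⟩ := P.eventually_extension_eq.self_of_nhds
  exact h.trans P.map_zero

theorem CenteredPlot.extension_map_eventuallyEq {f : X → Y} (hf : DSmooth f) (P : CenteredPlot x) :
    (P.map hf).extension =ᶠ[𝓝 0] f ∘ P.extension := by
  filter_upwards [(P.map hf).eventually_extension_eq, P.eventually_extension_eq]
    with r ⟨_, hr⟩ ⟨_, hr'⟩
  exact hr.trans (congrArg f hr'.symm)

theorem CenteredPlot.isHom_iff {Q P : CenteredPlot x} {F : 𝔼 Q.dim → 𝔼 P.dim} :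
    Q.IsHom P F ↔ F 0 = 0 ∧ (∃ W ∈ 𝓝 0, ContDiffOn ℝ ∞ F W) ∧
      Q.extension =ᶠ[𝓝 0] P.extension ∘ F := by
  have htendsto (hF0 : F 0 = 0) {W : Set (𝔼 Q.dim)} (hW : W ∈ 𝓝 0) (hF : ContDiffOn ℝ ∞ F W) :
      Filter.Tendsto F (𝓝 0) (𝓝 0) := by
    simpa only [ContinuousAt, hF0] using hF.continuousOn.continuousAt hW
  constructor
  · rintro ⟨hF0, W, hW0, hF, hW⟩
    have hW' := W.isOpen.mem_nhds hW0
    refine ⟨hF0, ⟨W, hW', hF⟩, ?_⟩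
    filter_upwards [hW', Q.eventually_extension_eq,
      (htendsto hF0 hW' hF).eventually P.eventually_extension_eq] with r hr ⟨_, hQ⟩ ⟨_, hP⟩
    obtain ⟨_, _, hQP⟩ := hW r hr
    exact hQ.trans (hQP.trans hP.symm)
  · rintro ⟨hF0, ⟨W, hW, hF⟩, he⟩
    have hfactor : ∀ᶠ r in 𝓝 0, r ∈ W ∧ ∃ (hQ : r ∈ Q.domain) (hP : F r ∈ P.domain),
        Q.toFun ⟨r, hQ⟩ = P.toFun ⟨F r, hP⟩ := by
      filter_upwards [hW, he, Q.eventually_extension_eq,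
        (htendsto hF0 hW hF).eventually P.eventually_extension_eq] with r hr hr' ⟨hQ, hQr⟩ ⟨hP, hPr⟩
      exact ⟨hr, hQ, hP, hQr.symm.trans (hr'.trans hPr)⟩
    obtain ⟨V, hV, hVopen, hV0⟩ := eventually_nhds_iff.1 hfactor
    exact ⟨hF0, ⟨V, hVopen⟩, hV0, hF.mono fun r hr => (hV r hr).1, fun r hr => (hV r hr).2⟩

theorem CenteredPlot.isHom_of_contDiff {Q P : CenteredPlot x} {F : 𝔼 Q.dim → 𝔼 P.dim}
    (hF : ContDiff ℝ ∞ F) (hF0 : F 0 = 0) (he : Q.extension =ᶠ[𝓝 0] P.extension ∘ F) :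
    Q.IsHom P F :=
  isHom_iff.2 ⟨hF0, ⟨Set.univ, Filter.univ_mem, hF.contDiffOn⟩, he⟩

theorem CenteredPlot.IsHom.differentiableAt {Q P : CenteredPlot x} {F : 𝔼 Q.dim → 𝔼 P.dim}
    (hF : Q.IsHom P F) : DifferentiableAt ℝ F 0 := by
  obtain ⟨-, ⟨W, hW, hFW⟩, -⟩ := isHom_iff.1 hF
  exact (hFW.contDiffAt hW).differentiableAt (by simp)

/-- A plot on a whole space, centered at its value at `0`. -/
abbrev CenteredPlot.ofPlot {n : ℕ} {p : 𝔼 n → X} (hp : IsPlot p) (h0 : p 0 = x) :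
    CenteredPlot x where
  dim := n
  domain := ⊤
  zero_mem := trivial
  toFun r := p r
  smooth := hp.dSmooth.comp dSmooth_val
  map_zero := h0

theorem CenteredPlot.extension_ofPlot_eventuallyEq {n : ℕ} {p : 𝔼 n → X} (hp : IsPlot p)
    (h0 : p 0 = x) : (ofPlot hp h0).extension =ᶠ[𝓝 0] p :=
  (ofPlot hp h0).eventually_extension_eq.mono fun _ ⟨_, hr⟩ => hr

open Classical in
/-- The linear map out of the colimit `T_x X` determined by a cocone `φ` over the centered plots. -/
noncomputable def InternalTangentSpace.desc {V : Type*} [AddCommGroup V] [Module ℝ V]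
    (φ : ∀ P : CenteredPlot x, 𝔼 P.dim →ₗ[ℝ] V)
    (hφ : ∀ (Q P : CenteredPlot x) (F : 𝔼 Q.dim → 𝔼 P.dim), Q.IsHom P F →
      ∀ v, φ P (fderiv ℝ F 0 v) = φ Q v) : InternalTangentSpace x →ₗ[ℝ] V :=
  (tangentRelations x).liftQ (DirectSum.toModule ℝ (CenteredPlot x) V φ) <| by
    refine Submodule.span_le.2 ?_
    rintro _ ⟨Q, P, F, v, hF, rfl⟩
    rw [SetLike.mem_coe, LinearMap.mem_ker, map_sub, DirectSum.toModule_lof,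
      DirectSum.toModule_lof, sub_eq_zero]
    exact (hφ Q P F hF v).symm

theorem InternalTangentSpace.desc_d {V : Type*} [AddCommGroup V] [Module ℝ V]
    (φ : ∀ P : CenteredPlot x, 𝔼 P.dim →ₗ[ℝ] V)
    (hφ : ∀ (Q P : CenteredPlot x) (F : 𝔼 Q.dim → 𝔼 P.dim), Q.IsHom P F →
      ∀ v, φ P (fderiv ℝ F 0 v) = φ Q v) (P : CenteredPlot x) (v : 𝔼 P.dim) :
    desc φ hφ (P.d v) = φ P v := by
  classical
  exact DirectSum.toModule_lof ℝ (φ := φ) P v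

theorem InternalTangentSpace.hom_ext {V : Type*} [AddCommGroup V] [Module ℝ V]
    {S T : InternalTangentSpace x →ₗ[ℝ] V}
    (h : ∀ (P : CenteredPlot x) (v : 𝔼 P.dim), S (P.d v) = T (P.d v)) : S = T := by
  classical
  exact Submodule.linearMap_qext _ (DirectSum.linearMap_ext ℝ fun P => LinearMap.ext (h P))

/-- The lift of a centered plot along a map with unique lifts of germs. -/
noncomputable abbrev HasUniqueLiftsAt.liftPlot {f : X → Y} (h : HasUniqueLiftsAt f x)
    (P : CenteredPlot (f x)) : CenteredPlot x :=
  CenteredPlot.ofPlot (h.exists_lift P.isPlot_extension P.extension_zero).choose_spec.1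
    (h.exists_lift P.isPlot_extension P.extension_zero).choose_spec.2.1

theorem HasUniqueLiftsAt.comp_extension_liftPlot {f : X → Y} (h : HasUniqueLiftsAt f x)
    (P : CenteredPlot (f x)) : f ∘ (h.liftPlot P).extension =ᶠ[𝓝 0] P.extension :=
  ((CenteredPlot.extension_ofPlot_eventuallyEq _ _).fun_comp f).trans
    (h.exists_lift P.isPlot_extension P.extension_zero).choose_spec.2.2

theorem HasUniqueLiftsAt.isHom_liftPlot {f : X → Y} (h : HasUniqueLiftsAt f x)
    {Q P : CenteredPlot (f x)} {F : 𝔼 Q.dim → 𝔼 P.dim} (hF : Q.IsHom P F) :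
    (h.liftPlot Q).IsHom (h.liftPlot P) F := by
  obtain ⟨hF0, ⟨W, hW, hFW⟩, he⟩ := CenteredPlot.isHom_iff.1 hF
  refine CenteredPlot.isHom_iff.2 ⟨hF0, ⟨W, hW, hFW⟩, ?_⟩
  obtain ⟨κ, hκ, hκW, hκid⟩ := exists_contDiff_mem_eventuallyEq_id hW
  have hFκ : F ∘ κ =ᶠ[𝓝 0] F := hκid.fun_comp F
  have hFκs : ContDiff ℝ ∞ (F ∘ κ) := hFW.comp_contDiff hκ hκW
  have hFκ0 : (F ∘ κ) 0 = 0 := hFκ.self_of_nhds.trans hF0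
  have htendsto : Filter.Tendsto (F ∘ κ) (𝓝 0) (𝓝 0) := by
    simpa only [hFκ0] using hFκs.continuous.tendsto 0
  refine (h.eventuallyEq (h.liftPlot Q).isPlot_extension
    (isPlot_reparam (h.liftPlot P).isPlot_extension hFκs) (h.liftPlot Q).extension_zero
    ((congrArg _ hFκ0).trans (h.liftPlot P).extension_zero) ?_).trans
    (hFκ.fun_comp (h.liftPlot P).extension)
  calc f ∘ (h.liftPlot Q).extension
      =ᶠ[𝓝 0] Q.extension := h.comp_extension_liftPlot Q
    _ =ᶠ[𝓝 0] P.extension ∘ F := he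
    _ =ᶠ[𝓝 0] P.extension ∘ (F ∘ κ) := (hFκ.fun_comp P.extension).symm
    _ =ᶠ[𝓝 0] f ∘ (h.liftPlot P).extension ∘ (F ∘ κ) :=
      ((h.comp_extension_liftPlot P).comp_tendsto htendsto).symm

theorem HasUniqueLiftsAt.bijective_internalTangentMap {f : X → Y} (h : HasUniqueLiftsAt f x)
    (hf : DSmooth f) : Function.Bijective (internalTangentMap hf x) := by
  let inv : InternalTangentSpace (f x) →ₗ[ℝ] InternalTangentSpace x :=
    InternalTangentSpace.desc (fun P => (h.liftPlot P).d)
      fun Q P F hF v => (h.isHom_liftPlot hF).d_comp v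
  have hinv (P : CenteredPlot (f x)) (v : 𝔼 P.dim) : inv (P.d v) = (h.liftPlot P).d v :=
    InternalTangentSpace.desc_d _ _ P v
  have hleft : inv ∘ₗ internalTangentMap hf x = LinearMap.id := by
    refine InternalTangentSpace.hom_ext fun P v => ?_
    have hhom : (h.liftPlot (P.map hf)).IsHom P id :=
      CenteredPlot.isHom_of_contDiff contDiff_id rfl <|
        h.eventuallyEq (h.liftPlot _).isPlot_extension P.isPlot_extension
          (h.liftPlot _).extension_zero P.extension_zero <|
            (h.comp_extension_liftPlot _).trans (P.extension_map_eventuallyEq hf)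
    rw [LinearMap.comp_apply, internalTangentMap_d, hinv, ← hhom.d_comp, fderiv_id]
    rfl
  have hright : internalTangentMap hf x ∘ₗ inv = LinearMap.id := by
    refine InternalTangentSpace.hom_ext fun P v => ?_
    have hhom : ((h.liftPlot P).map hf).IsHom P id :=
      CenteredPlot.isHom_of_contDiff contDiff_id rfl <|
        ((h.liftPlot P).extension_map_eventuallyEq hf).trans (h.comp_extension_liftPlot P)
    rw [LinearMap.comp_apply, hinv, internalTangentMap_d, ← hhom.d_comp, fderiv_id]
    rfl
  exact Function.bijective_iff_has_inverse.2
    ⟨inv, LinearMap.congr_fun hleft, LinearMap.congr_fun hright⟩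

theorem bijective_d_ofPlot_id (n : ℕ) :
    Function.Bijective (CenteredPlot.ofPlot (isPlot_id (n := n)) rfl).d := by
  let I : CenteredPlot (0 : 𝔼 n) := CenteredPlot.ofPlot isPlot_id rfl
  have hI : I.extension =ᶠ[𝓝 0] id := CenteredPlot.extension_ofPlot_eventuallyEq _ _
  have hdiff (P : CenteredPlot (0 : 𝔼 n)) : DifferentiableAt ℝ P.extension 0 :=
    P.isPlot_extension.contDiff.differentiable (by simp) 0
  let inv : InternalTangentSpace (0 : 𝔼 n) →ₗ[ℝ] 𝔼 n :=
    InternalTangentSpace.desc (fun P => (fderiv ℝ P.extension 0).toLinearMap) fun Q P F hF v => by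
      obtain ⟨hF0, -, he⟩ := CenteredPlot.isHom_iff.1 hF
      have hchain := fderiv_comp 0 (hF0.symm ▸ hdiff P) hF.differentiableAt
      rw [hF0, ← he.fderiv_eq] at hchain
      exact (DFunLike.congr_fun hchain v).symm
  have hinv (P : CenteredPlot (0 : 𝔼 n)) (v : 𝔼 P.dim) : inv (P.d v) = fderiv ℝ P.extension 0 v :=
    InternalTangentSpace.desc_d _ _ P v
  have hright : I.d ∘ₗ inv = LinearMap.id := by
    refine InternalTangentSpace.hom_ext fun P v => ?_
    have hhom : P.IsHom I P.extension := by
      refine CenteredPlot.isHom_of_contDiff P.isPlot_extension.contDiff P.extension_zero ?_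
      have htendsto : Filter.Tendsto P.extension (𝓝 0) (𝓝 0) := by
        simpa only [P.extension_zero] using P.isPlot_extension.contDiff.continuous.tendsto 0
      exact (hI.comp_tendsto htendsto).symm
    rw [LinearMap.comp_apply, hinv]
    exact hhom.d_comp v
  refine Function.bijective_iff_has_inverse.2 ⟨inv, fun v => ?_, LinearMap.congr_fun hright⟩
  rw [hinv, hI.fderiv_eq, fderiv_id]
  rfl

end Tangent

section Charts

variable {X : Type u} {Y : Type v} [DiffeologicalSpace X] [DiffeologicalSpace Y] {x : X}

/-- A chart at `x`: a plot defined on a whole space `ℝⁿ`, centered at `x` and étale at `0`. -/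
structure IsChartAt {n : ℕ} (p : 𝔼 n → X) (x : X) : Prop where
  isPlot : IsPlot p
  map_zero : p 0 = x
  hasUniqueLiftsAt : HasUniqueLiftsAt p 0

theorem IsEtaleManifold.exists_isChartAt {n : ℕ} (hX : IsEtaleManifold n X) (x : X) :
    ∃ p : 𝔼 n → X, IsChartAt p x := by
  obtain ⟨A, hA, hcover⟩ := hX
  obtain ⟨⟨U, φ⟩, hφA, u, rfl⟩ := hcover x
  have hφ : IsDiffeologicalEtale φ := hA _ hφA
  have htrans : ContDiff ℝ ∞ fun r : 𝔼 n => (u : 𝔼 n) + r := contDiff_const.add contDiff_id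
  have htrans_lifts : HasUniqueLiftsAt (fun r : 𝔼 n => (u : 𝔼 n) + r) 0 :=
    hasUniqueLiftsAt_of_bijective_fderiv htrans <| by
      rw [fderiv_const_add, fderiv_fun_id]
      exact Function.bijective_id
  have hval : HasUniqueLiftsAt (Subtype.val : U → 𝔼 n) u :=
    hasUniqueLiftsAt_val (IsDTopologyCompatible.dTop_eq (X := 𝔼 n) ▸ U.isOpen) u
  obtain ⟨τ, hτ, rfl, hτe⟩ := hval.exists_lift htrans.isPlot (add_zero (u : 𝔼 n))
  have hτlifts : HasUniqueLiftsAt τ 0 :=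
    (htrans_lifts.congr hτe.symm).of_comp_left hval dSmooth_val hτ.dSmooth
  exact ⟨φ ∘ τ, hφ.1 _ _ hτ, rfl, (hφ.hasUniqueLiftsAt _).comp hτlifts hτ.dSmooth⟩

theorem IsChartAt.bijective_d {n : ℕ} {p : 𝔼 n → X} (hp : IsChartAt p x) :
    Function.Bijective (CenteredPlot.ofPlot hp.isPlot hp.map_zero).d := by
  obtain ⟨hplot, rfl, hlifts⟩ := hp
  have hcomp : ⇑(CenteredPlot.ofPlot hplot rfl).d =
      internalTangentMap hplot.dSmooth 0 ∘ (CenteredPlot.ofPlot isPlot_id rfl).d :=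
    funext fun v => (internalTangentMap_d hplot.dSmooth (CenteredPlot.ofPlot isPlot_id rfl) v).symm
  rw [hcomp]
  exact (hlifts.bijective_internalTangentMap _).comp (bijective_d_ofPlot_id n)

theorem IsChartAt.bijective_internalTangentMap_iff {n l : ℕ} {p : 𝔼 n → X} {q : 𝔼 l → Y}
    {f : X → Y} (hf : DSmooth f) (hp : IsChartAt p x) (hq : IsChartAt q (f x)) {F : 𝔼 n → 𝔼 l}
    (hF : ContDiff ℝ ∞ F) (hF0 : F 0 = 0) (he : q ∘ F =ᶠ[𝓝 0] f ∘ p) :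
    Function.Bijective (internalTangentMap hf x) ↔ Function.Bijective (fderiv ℝ F 0) := by
  let P := CenteredPlot.ofPlot hp.isPlot hp.map_zero
  let Q := CenteredPlot.ofPlot hq.isPlot hq.map_zero
  have htendsto : Filter.Tendsto F (𝓝 0) (𝓝 0) := by
    simpa only [hF0] using hF.continuous.tendsto 0
  have hhom : (P.map hf).IsHom Q F := CenteredPlot.isHom_of_contDiff hF hF0 <| by
    calc (P.map hf).extension
        =ᶠ[𝓝 0] f ∘ P.extension := P.extension_map_eventuallyEq hf
      _ =ᶠ[𝓝 0] f ∘ p := (CenteredPlot.extension_ofPlot_eventuallyEq _ _).fun_comp f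
      _ =ᶠ[𝓝 0] q ∘ F := he.symm
      _ =ᶠ[𝓝 0] Q.extension ∘ F :=
        ((CenteredPlot.extension_ofPlot_eventuallyEq _ _).comp_tendsto htendsto).symm
  have hcomm : internalTangentMap hf x ∘ P.d = Q.d ∘ fderiv ℝ F 0 :=
    funext fun v => (internalTangentMap_d hf P v).trans (hhom.d_comp v).symm
  rw [← Function.Bijective.of_comp_iff _ hp.bijective_d, hcomm,
    Function.Bijective.of_comp_iff' hq.bijective_d]

end Charts

section Track

/-- The track map `(Pr₁, f)` of the implicit function theorem. -/
abbrev track {M N L : Type*} (f : M × N → L) : M × N → M × L := fun z => (z.1, f z)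

variable {M : Type u} {N : Type v} {L : Type w} [DiffeologicalSpace M] [DiffeologicalSpace N]
  [DiffeologicalSpace L] {f : M × N → L} {x : M} {y : N}

theorem HasUniqueLiftsAt.slice (h : HasUniqueLiftsAt (track f) (x, y)) :
    HasUniqueLiftsAt (fun y => f (x, y)) y where
  exists_lift {n p} hp r₀ h0 := by
    obtain ⟨q, hq, hq0, hqp⟩ := h.exists_lift (p := fun r => (x, p r)) ⟨isPlot_const, hp⟩
      (Prod.ext rfl h0)
    refine ⟨fun r => (q r).2, hq.2, congrArg Prod.snd hq0, ?_⟩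
    filter_upwards [hqp] with r hr
    obtain ⟨hfst, hsnd⟩ := Prod.mk.inj hr
    exact (congrArg (fun x => f (x, (q r).2)) hfst.symm).trans hsnd
  eventuallyEq {n q q'} hq hq' r₀ h0 h0' he :=
    (h.eventuallyEq (q := fun r => (x, q r)) (q' := fun r => (x, q' r)) ⟨isPlot_const, hq⟩
      ⟨isPlot_const, hq'⟩ (Prod.ext rfl h0) (Prod.ext rfl h0') (he.fun_comp (Prod.mk x))).fun_comp
        Prod.snd

theorem hasUniqueLiftsAt_track_of_plots
    (h : ∀ {k : ℕ} {a : 𝔼 k → M}, IsPlot a → ∀ {r₀ : 𝔼 k}, a r₀ = x →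
      HasUniqueLiftsAt (track (f ∘ Prod.map a id)) (r₀, y)) :
    HasUniqueLiftsAt (track f) (x, y) where
  exists_lift {k c} hc r₀ h0 := by
    obtain ⟨hc₁, hc₂⟩ : (c r₀).1 = x ∧ (c r₀).2 = f (x, y) := Prod.mk.inj h0
    obtain ⟨q, hq, hq0, hqc⟩ := (h hc.1 hc₁).exists_lift (p := fun r => (r, (c r).2))
      ⟨isPlot_id, hc.2⟩ (r₀ := r₀)
      (Prod.ext rfl (hc₂.trans (congrArg (fun x => f (x, y)) hc₁.symm)))
    have hq₂ : (q r₀).2 = y := congrArg Prod.snd hq0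
    refine ⟨fun r => ((c r).1, (q r).2), ⟨hc.1, hq.2⟩, Prod.ext hc₁ hq₂, ?_⟩
    filter_upwards [hqc] with r hr
    obtain ⟨hfst, hsnd⟩ : (q r).1 = r ∧ f ((c (q r).1).1, (q r).2) = (c r).2 := Prod.mk.inj hr
    exact Prod.ext rfl (by rwa [hfst] at hsnd)
  eventuallyEq {k c c'} hc hc' r₀ h0 h0' he := by
    obtain ⟨hc₁, hc₂⟩ : (c r₀).1 = x ∧ (c r₀).2 = y := Prod.mk.inj h0
    have hc₂' : (c' r₀).2 = y := congrArg Prod.snd h0'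
    have htrack : ∀ᶠ r in 𝓝 r₀, (c r).1 = (c' r).1 ∧ f (c r) = f (c' r) :=
      he.mono fun r hr => Prod.mk.inj hr
    have hlifts := (h hc.1 hc₁).eventuallyEq (q := fun r => (r, (c r).2))
      (q' := fun r => (r, (c' r).2)) ⟨isPlot_id, hc.2⟩ ⟨isPlot_id, hc'.2⟩ (r₀ := r₀)
      (Prod.ext rfl hc₂) (Prod.ext rfl hc₂') <| by
        filter_upwards [htrack] with r ⟨hfst, hsnd⟩
        exact Prod.ext rfl (hsnd.trans (congrArg (fun x => f (x, (c' r).2)) hfst.symm))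
    filter_upwards [htrack, hlifts] with r ⟨hfst, _⟩ hr
    exact Prod.ext hfst (Prod.mk.inj hr).2

theorem hasUniqueLiftsAt_track_of_charts {E : Type*} [NormedAddCommGroup E] [NormedSpace ℝ E]
    [FiniteDimensional ℝ E] [DiffeologicalSpace E] [IsContDiffCompatible E] {g : E × N → L}
    (hg : DSmooth g) {e : E} {n l : ℕ} {p : 𝔼 n → N} (hp : IsChartAt p y) {q : 𝔼 l → L}
    (hq : IsChartAt q (g (e, y)))
    (hbij : Function.Bijective (internalTangentMap (dSmooth_slice hg e) y)) :
    HasUniqueLiftsAt (track g) (e, y) := by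
  have hidp : DSmooth (Prod.map id p : E × 𝔼 n → E × N) :=
    dSmooth_prodMk dSmooth_fst (hp.isPlot.dSmooth.comp dSmooth_snd)
  obtain ⟨F, hF, hF0, hqF⟩ := hq.hasUniqueLiftsAt.exists_lift_normedSpace
    (hg.comp hidp) (a := (e, 0)) (by simp [hp.map_zero, hq.map_zero])
  have hFs : ContDiff ℝ ∞ F := hF.contDiff
  have hslice : Function.Bijective (fderiv ℝ (fun v => F (e, v)) 0) :=
    (hp.bijective_internalTangentMap_iff (dSmooth_slice hg e) hq
      (hFs.comp (contDiff_prodMk_right e)) hF0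
      (hqF.comp_tendsto ((Continuous.prodMk_right e).tendsto 0))).1 hbij
  have htrackF : HasUniqueLiftsAt (track F) (e, 0) :=
    hasUniqueLiftsAt_of_bijective_fderiv (contDiff_fst.prodMk hFs)
      (bijective_fderiv_fst_prodMk (hFs.differentiable (by simp) _) hslice)
  have hidq : HasUniqueLiftsAt (Prod.map id q) (track F (e, 0)) :=
    hasUniqueLiftsAt_id.prodMap (X := E) (hF0.symm ▸ hq.hasUniqueLiftsAt)
  have hcomm : Prod.map id q ∘ track F =ᶠ[𝓝 (e, 0)] track g ∘ Prod.map id p :=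
    hqF.mono fun z hz => Prod.ext rfl hz
  have hcomp : HasUniqueLiftsAt (track g ∘ Prod.map id p) (e, 0) :=
    (hidq.comp htrackF (dSmooth_prodMk dSmooth_fst hF)).congr hcomm
  simpa only [Prod.map_apply, id, hp.map_zero] using
    hcomp.of_comp_right (hasUniqueLiftsAt_id.prodMap hp.hasUniqueLiftsAt) hidp

end Track

end EtaleDiffeology

open EtaleDiffeology in
theorem theorem6p13_general {M N L : Type*} [DiffeologicalSpace M] [DiffeologicalSpace N]
    [DiffeologicalSpace L] {n l : ℕ} (hN : IsEtaleManifold n N) (hL : IsEtaleManifold l L)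
    (f : M × N → L) (hf : DSmooth f) :
    (∀ (x : M) (y : N), Function.Bijective (internalTangentMap (dSmooth_slice hf x) y)) ↔
      IsDiffeologicalEtale (fun p : M × N => (p.1, f p)) := by
  rw [isDiffeologicalEtale_iff]
  constructor
  · refine fun hbij => ⟨dSmooth_prodMk dSmooth_fst hf, fun ⟨x, y⟩ => ?_⟩
    refine hasUniqueLiftsAt_track_of_plots fun {k a} ha r₀ _ => ?_
    obtain ⟨p, hp⟩ := hN.exists_isChartAt y
    obtain ⟨q, hq⟩ := hL.exists_isChartAt (f (a r₀, y))
    have hfa : DSmooth (f ∘ Prod.map a id) :=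
      hf.comp (dSmooth_prodMk (ha.dSmooth.comp dSmooth_fst) dSmooth_snd)
    exact hasUniqueLiftsAt_track_of_charts hfa hp hq (hbij (a r₀) y)
  · rintro ⟨-, hlifts⟩ x y
    exact (hlifts (x, y)).slice.bijective_internalTangentMap (dSmooth_slice hf x)

theorem theorem6p13 {M N L : Type*} [DiffeologicalSpace M] [DiffeologicalSpace N]
    [DiffeologicalSpace L] {m n l : ℕ} (hM : EtaleDiffeology.IsEtaleManifold m M)
    (hN : EtaleDiffeology.IsEtaleManifold n N) (hL : EtaleDiffeology.IsEtaleManifold l L)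
    (f : M × N → L) (hf : DSmooth f) :
    (∀ (x : M) (y : N), Function.Bijective
      (EtaleDiffeology.internalTangentMap (EtaleDiffeology.dSmooth_slice hf x) y)) ↔
    EtaleDiffeology.IsDiffeologicalEtale (fun p : M × N => (p.1, f p)) :=
  theorem6p13_general hN hL f hf
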